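/- Let $p$ be a prime, let $s, r, m \geq 1$ be integers with $rm \geq s$, put $q = p^r$ and $n = q^m - 1$, and let $\nu$ be an integer with $0 \leq \nu \leq m(q-1)$. Let $L = GR(p^s, r)$ be the Galois ring of characteristic $p^s$ with $p^{sr}$ elements, that is, $L \cong (\mathbb{Z}/p^s)[x]/(f)$ with $f$ monic of degree $r$ and irreducible modulo $p$. Let $h \in L[x]$ be a monic basic primitive polynomial of degree $m$ (its reduction over $L/pL = \mathbb{F}_q$ is irreducible, with a root of multiplicative order $n$) that divides $x^{n} - 1$ and is such that the class $\xi$ of $x$ in $L[x]/(h)$ has multiplicative order $n$. For $0 \leq i \leq n-1$ write $\xi^i = b_{1i} + b_{2i}\xi + \dots + b_{mi}\xi^{m-1}$ with $b_{ji} \in L$, and put $b_i = (b_{1i}, \dots, b_{mi}) \in L^m$ and $b_\infty = (0, \dots, 0)$. The generalized Reed–Muller code of order $\nu$ and length $q^m$ over $L$ is $$RM_L(\nu, m) = \{ (P(b_\infty), P(b_0), \dots, P(b_{n-1})) \mid P \in L[x_1, \dots, x_m],\ \deg_{x_i} P \leq q-1 \text{ for all } i,\ \deg P \leq \nu \}.$$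 Then $RM_L(\nu, m)$ is a free $L$-module of rank $$k = \sum_{i=0}^{\nu} \sum_{j=0}^{m} (-1)^j \binom{m}{j} \binom{i - jq + m - 1}{i - jq},$$ where $\binom{a}{b} = 0$ for $b < 0$. Moreover, $k$ is also the dimension over $\mathbb{F}_q$ of the usual generalized Reed–Muller code $RM_{\mathbb{F}_q}(\nu, m)$, which consists of the vectors $(P(a))_{a \in \mathbb{F}_q^m}$ for the polynomials $P \in \mathbb{F}_q[x_1, \dots, x_m]$ with $\deg_{x_i} P \leq q-1$ for all $i$ and $\deg P \leq \nu$. -/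

import Mathlib

open Polynomial

/-- The reduction modulo `p` of a polynomial with coefficients in `A`: a polynomial with
coefficients in `A ⧸ pA`. -/
noncomputable def redMod {A : Type*} [CommRing A] (p : ℕ) (f : A[X]) :
    (A ⧸ Ideal.span {(p : A)})[X] :=
  f.map (Ideal.Quotient.mk (Ideal.span {(p : A)}))

/-- `L` is the Galois ring `GR(p^s, r)`: it is isomorphic to `(ℤ/p^s)[x]/(f)` for a monic polynomial
`f` of degree `r` which is basic irreducible, that is, irreducible modulo `p`. -/
def IsGaloisRing (p s r : ℕ) (L : Type*) [CommRing L] : Prop :=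
  ∃ f : (ZMod (p ^ s))[X], f.Monic ∧ f.natDegree = r ∧ Irreducible (redMod p f) ∧
    Nonempty (L ≃+* AdjoinRoot f)

/-- `h` is a basic primitive polynomial of degree `m` over `L`, where `L ⧸ pL` is the field with `q`
elements: its reduction modulo `p` is irreducible over `L ⧸ pL`, and the roots of
this reduction have multiplicative order `q ^ m - 1`. -/
def IsBasicPrimitive {L : Type*} [CommRing L] (p q m : ℕ) (h : L[X]) : Prop :=
  h.natDegree = m ∧ Irreducible (redMod p h) ∧
    orderOf (AdjoinRoot.root (redMod p h)) = q ^ m - 1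

/-- The polynomials `h` used to present `GR(p^s, rm)` as `L[x]/(h)`: monic basic primitive of degree
`m`, dividing `x ^ (q ^ m - 1) - 1`, and such that the class `ξ` of `x` in `L[x]/(h)` has
multiplicative order `q ^ m - 1`. -/
structure IsPrimitiveModulus {L : Type*} [CommRing L] (p q m : ℕ) (h : L[X]) : Prop where
  monic : h.Monic
  basicPrimitive : IsBasicPrimitive p q m h
  dvd : h ∣ X ^ (q ^ m - 1) - 1
  orderOf_root : orderOf (AdjoinRoot.root h) = q ^ m - 1

/-- The basis `1, ξ, …, ξ ^ (m - 1)` of `L[x]/(h)` over `L`, where `ξ` is the class of `x`. -/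
noncomputable def primitiveBasis {L : Type*} [CommRing L] {p q m : ℕ} {h : L[X]}
    (hh : IsPrimitiveModulus p q m h) : Module.Basis (Fin m) L (AdjoinRoot h) :=
  (AdjoinRoot.powerBasis' hh.monic).basis.reindex
    (finCongr ((AdjoinRoot.powerBasis'_dim hh.monic).trans hh.basicPrimitive.1))

theorem primitiveBasis_apply {L : Type*} [CommRing L] {p q m : ℕ} {h : L[X]}
    (hh : IsPrimitiveModulus p q m h) (j : Fin m) :
    primitiveBasis hh j = AdjoinRoot.root h ^ (j : ℕ) := by
  simp [primitiveBasis]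

/-- The points `b_∞ = 0` and `b_i = (b_{1i}, …, b_{mi})`, `0 ≤ i ≤ n - 1`, where `n = q ^ m - 1` and
the `b_{ji}` are the coordinates of `ξ ^ i` in the basis `1, ξ, …, ξ ^ (m - 1)`.
The index `∞` is `none`. -/
noncomputable def grmPoint {L : Type*} [CommRing L] {p q m : ℕ} {h : L[X]}
    (hh : IsPrimitiveModulus p q m h) : Option (Fin (q ^ m - 1)) → Fin m → L
  | none => 0
  | some i => fun j => (primitiveBasis hh).repr (AdjoinRoot.root h ^ (i : ℕ)) j

theorem root_pow_eq_sum_grmPoint {L : Type*} [CommRing L] {p q m : ℕ} {h : L[X]}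
    (hh : IsPrimitiveModulus p q m h) (i : Fin (q ^ m - 1)) :
    AdjoinRoot.root h ^ (i : ℕ) =
      ∑ j : Fin m, grmPoint hh (some i) j • AdjoinRoot.root h ^ (j : ℕ) := by
  conv_lhs => rw [← (primitiveBasis hh).sum_repr (AdjoinRoot.root h ^ (i : ℕ))]
  simp [primitiveBasis_apply, grmPoint]

/-- The evaluation map `P ↦ (P (a_c))_c` at a family of points `a_c` of `A ^ m`. -/
noncomputable def evalMap {A ι : Type*} [CommRing A] {m : ℕ} (a : ι → Fin m → A) :
    MvPolynomial (Fin m) A →ₗ[A] (ι → A) :=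
  LinearMap.pi fun c => (MvPolynomial.aeval (a c)).toLinearMap

/-- The code of all `ev(P)` with `deg P ≤ ν` and `deg_{x_i} P ≤ q - 1` for every `i`. -/
noncomputable def evalCode {A ι : Type*} [CommRing A] {m : ℕ} (a : ι → Fin m → A) (q ν : ℕ) :
    Submodule A (ι → A) :=
  (MvPolynomial.restrictDegree (Fin m) A (q - 1) ⊓
    MvPolynomial.restrictTotalDegree (Fin m) A ν).map (evalMap a)

theorem mem_evalCode {A ι : Type*} [CommRing A] {m : ℕ} (a : ι → Fin m → A) (q ν : ℕ)
    (v : ι → A) : v ∈ evalCode a q ν ↔ ∃ P : MvPolynomial (Fin m) A,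
      (∀ i, P.degreeOf i ≤ q - 1) ∧ P.totalDegree ≤ ν ∧
        v = fun c => MvPolynomial.eval (a c) P := by
  simp only [evalCode, Submodule.mem_map, Submodule.mem_inf, evalMap,
    MvPolynomial.mem_restrictTotalDegree, MvPolynomial.mem_restrictDegree,
    MvPolynomial.degreeOf_le_iff]
  constructor
  · rintro ⟨P, ⟨h1, h2⟩, rfl⟩
    exact ⟨P, fun i s hs => h1 s hs i, h2, by ext c; simp [MvPolynomial.aeval_eq_eval]⟩
  · rintro ⟨P, h1, h2, rfl⟩
    exact ⟨P, ⟨fun s hs i => h1 i s hs, h2⟩, by ext c; simp [MvPolynomial.aeval_eq_eval]⟩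

/-- The generalized Reed-Muller code `RM_L(ν, m)` over `L`, a submodule of
`L ^ (q ^ m)`, with coordinates numbered `∞, 0, 1, …, q ^ m - 2`. -/
noncomputable def grmCode {L : Type*} [CommRing L] {p q m : ℕ} {h : L[X]}
    (hh : IsPrimitiveModulus p q m h) (ν : ℕ) : Submodule L (Option (Fin (q ^ m - 1)) → L) :=
  evalCode (grmPoint hh) q ν

/-- The usual generalized Reed-Muller code of order `ν` over the finite field `K` with `q` elements:
its words are the value tables on `K ^ m` of the polynomials in `m` variables of degree at most `ν`
(and of degree at most `q - 1` in each variable). -/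
noncomputable def fieldGRMCode (K : Type*) [Field K] (q ν m : ℕ) :
    Submodule K ((Fin m → K) → K) :=
  evalCode (fun a : Fin m → K => a) q ν

/-- The binomial coefficient `C(a, b)` for integers `a`, `b`, which is `0` for `b < 0`. -/
def intBinom (a b : ℤ) : ℤ := if b < 0 then 0 else Ring.choose a b.toNat

/-- The number `∑_{i=0}^{ν} ∑_{j=0}^{m} (-1)^j C(m, j) C(i - jq + m - 1, i - jq)`. -/
def grmRank (q ν m : ℕ) : ℤ :=
  ∑ i ∈ Finset.range (ν + 1), ∑ j ∈ Finset.range (m + 1),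
    (-1) ^ j * (m.choose j : ℤ) *
      intBinom ((i : ℤ) - (j : ℤ) * (q : ℤ) + (m : ℤ) - 1) ((i : ℤ) - (j : ℤ) * (q : ℤ))

/-! The code is spanned by the words of the monomials with exponents below `q` and degree at most
`ν`, so everything reduces to the independence of all `q ^ m` monomial words, a square family.
Modulo `p` the points run once through `𝔽_q ^ m` (`residue_grmPoint_injective`), where reduced
polynomials represent every function, so the determinant is nonzero. As `p` is nilpotent in `L`, the
determinant is already a unit in `L` (`linearIndependent_of_nilpotent_quotient`).

Hence over `L` and over `𝔽_q` alike the rank is the number of `e ∈ [0, q-1]^m` with sum at most `ν`.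
The formula for it is read off from `(1 + x + ⋯ + x^(q-1))^m = (1 - x^q)^m (1 - x)^(-m)`. -/

/-- The word of values of the monomial with exponents `e` at the points `a`. -/
def monomialWord {A ι : Type*} [CommRing A] {m q : ℕ} (a : ι → Fin m → A) (e : Fin m → Fin q) :
    ι → A :=
  fun c => ∏ j, a c j ^ (e j : ℕ)

/-! ### Evaluation codes and their monomial generators. -/

theorem evalMap_monomial {A ι : Type*} [CommRing A] {m : ℕ} (a : ι → Fin m → A)
    (n : Fin m →₀ ℕ) :
    evalMap a (MvPolynomial.monomial n 1) = fun c => ∏ j, a c j ^ n j := by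
  ext c
  simp [evalMap, MvPolynomial.aeval_monomial, Finsupp.prod_fintype]

theorem evalCode_eq_span {A ι : Type*} [CommRing A] {m q : ℕ} (hq : 0 < q) (a : ι → Fin m → A)
    (ν : ℕ) :
    evalCode a q ν = Submodule.span A (Set.range
      fun e : {e : Fin m → Fin q // ∑ j, (e j : ℕ) ≤ ν} => monomialWord a e.1) := by
  have hinf : MvPolynomial.restrictDegree (Fin m) A (q - 1) ⊓
      MvPolynomial.restrictTotalDegree (Fin m) A ν =
      MvPolynomial.restrictSupport A
        ({n | ∀ i, n i ≤ q - 1} ∩ {n | (n.sum fun _ e => e) ≤ ν}) := by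
    ext P
    simp only [MvPolynomial.restrictDegree, MvPolynomial.restrictTotalDegree, Submodule.mem_inf,
      MvPolynomial.mem_restrictSupport_iff, Set.subset_inter_iff]
  rw [evalCode, hinf, MvPolynomial.restrictSupport_eq_span, Submodule.map_span]
  congr 1
  ext v
  constructor
  · rintro ⟨_, ⟨n, ⟨hn, hs⟩, rfl⟩, rfl⟩
    refine ⟨⟨fun j => ⟨n j, by have := hn j; omega⟩, ?_⟩, ?_⟩
    · simpa [Finsupp.sum_fintype] using hs
    · simp only [evalMap_monomial]
      rfl
  · rintro ⟨e, rfl⟩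
    refine ⟨_, ⟨Finsupp.equivFunOnFinite.symm fun j => (e.1 j : ℕ), ⟨?_, ?_⟩, rfl⟩, ?_⟩
    · intro i
      have := (e.1 i).2
      simp only [Finsupp.equivFunOnFinite_symm_apply_apply]
      omega
    · simpa [Finsupp.sum_fintype] using e.2
    · simp only [evalMap_monomial, Finsupp.equivFunOnFinite_symm_apply_apply]
      rfl

theorem free_evalCode {A ι : Type*} [CommRing A] {m q : ℕ} (hq : 0 < q)
    {a : ι → Fin m → A}
    (ha : LinearIndependent A (monomialWord a : (Fin m → Fin q) → ι → A)) (ν : ℕ) :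
    Module.Free A (evalCode a q ν) := by
  rw [evalCode_eq_span hq]
  exact Module.Free.of_basis (Module.Basis.span (ha.comp _ Subtype.val_injective))

theorem finrank_evalCode {A ι : Type*} [CommRing A] [Nontrivial A] {m q : ℕ} (hq : 0 < q)
    {a : ι → Fin m → A}
    (ha : LinearIndependent A (monomialWord a : (Fin m → Fin q) → ι → A)) (ν : ℕ) :
    Module.finrank A (evalCode a q ν) =
      Fintype.card {e : Fin m → Fin q // ∑ j, (e j : ℕ) ≤ ν} := by
  rw [evalCode_eq_span hq]
  exact finrank_span_eq_card (ha.comp _ Subtype.val_injective)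

/-! ### Independence over the finite field, and its lifting. -/

/-- Every function `K ^ m → K` is given by a reduced polynomial, so these `q ^ m` words span a space
of dimension `q ^ m`. -/
theorem linearIndependent_monomialWord_id {K : Type*} [Field K] {m q : ℕ} (hq : 0 < q)
    (hK : Nat.card K = q) :
    LinearIndependent K
      (monomialWord (fun a : Fin m → K => a) : (Fin m → Fin q) → (Fin m → K) → K) := by
  classical
  have : Finite K := Nat.finite_of_card_ne_zero (by omega)
  have := Fintype.ofFinite K
  rw [Nat.card_eq_fintype_card] at hK
  apply linearIndependent_of_top_le_span_of_card_eq_finrank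
  · have h := MvPolynomial.map_restrict_dom_evalₗ K (Fin m)
    rw [← h, hK, MvPolynomial.restrictDegree, MvPolynomial.restrictSupport_eq_span,
      Submodule.map_span]
    apply Submodule.span_mono
    rintro _ ⟨_, ⟨n, hn, rfl⟩, rfl⟩
    refine ⟨fun j => ⟨n j, ?_⟩, ?_⟩
    · have := hn j
      omega
    · ext c
      simp [monomialWord, MvPolynomial.eval_monomial, Finsupp.prod_fintype]
  · simp [hK]

theorem linearIndependent_monomialWord_of_bijective {K ι : Type*} [Field K] {m q : ℕ} (hq : 0 < q)
    (hK : Nat.card K = q) {a : ι → Fin m → K} (ha : Function.Bijective a) :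
    LinearIndependent K (monomialWord a : (Fin m → Fin q) → ι → K) :=
  (linearIndependent_monomialWord_id hq hK).map'
    (LinearMap.funLeft K K a) (LinearMap.ker_eq_bot.2
      (LinearMap.funLeft_injective_of_surjective K K a ha.surjective))

/-- Linear independence of a square family lifts along reduction modulo a nilpotent ideal. -/
theorem linearIndependent_of_nilpotent_quotient {A ι κ : Type*} [CommRing A] [Finite κ]
    {I : Ideal A} (hI : IsNilpotent I) (hF : IsField (A ⧸ I)) (ε : κ ≃ ι) (w : κ → ι → A)
    (hw : LinearIndependent (A ⧸ I) fun k c => Ideal.Quotient.mk I (w k c)) :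
    LinearIndependent A w := by
  classical
  have := Fintype.ofFinite κ
  let M : Matrix κ κ A := Matrix.of fun k l => w k (ε l)
  let := hF.toField
  have h1 : LinearIndependent (A ⧸ I) (M.map (Ideal.Quotient.mk I)).row :=
    hw.map' (LinearMap.funLeft (A ⧸ I) (A ⧸ I) ε) (LinearMap.ker_eq_bot.2
      (LinearMap.funLeft_injective_of_surjective _ _ _ ε.surjective))
  rw [Matrix.linearIndependent_rows_iff_isUnit, Matrix.isUnit_iff_isUnit_det] at h1
  -- The determinant commutes with reduction, and units lift along a nilpotent ideal.
  have h2 : IsUnit M.det := by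
    rw [← IsNilpotent.isUnit_quotient_mk_iff hI, RingHom.map_det]
    exact h1
  have h3 : LinearIndependent A M.row :=
    Matrix.linearIndependent_rows_of_isUnit ((Matrix.isUnit_iff_isUnit_det _).2 h2)
  exact LinearIndependent.of_comp (LinearMap.funLeft A A ε) h3

/-! ### Counting exponents by generating functions. -/

theorem card_eq_coeff_geom_pow (q m i : ℕ) :
    (Fintype.card {e : Fin m → Fin q // ∑ j, (e j : ℕ) = i} : ℤ) =
      PowerSeries.coeff i ((∑ k : Fin q, (PowerSeries.X : PowerSeries ℤ) ^ (k : ℕ)) ^ m) := by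
  rw [Fintype.sum_pow, map_sum, Fintype.card_subtype, Finset.card_filter]
  push_cast
  refine Finset.sum_congr rfl fun e _ => ?_
  rw [Finset.prod_pow_eq_pow_sum, PowerSeries.coeff_X_pow]
  simp [eq_comm]

theorem geom_pow_eq_mul_invOneSubPow (q m : ℕ) :
    (∑ k : Fin q, (PowerSeries.X : PowerSeries ℤ) ^ (k : ℕ)) ^ m =
      (1 - PowerSeries.X ^ q) ^ m * (PowerSeries.invOneSubPow ℤ m).val := by
  have h1 : (1 - PowerSeries.X : PowerSeries ℤ) ^ m * (PowerSeries.invOneSubPow ℤ m).val = 1 := by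
    simpa using PowerSeries.one_sub_pow_add_mul_invOneSubPow_val_eq_one_sub_pow ℤ 0 m
  rw [Fin.sum_univ_eq_sum_range (fun k => (PowerSeries.X : PowerSeries ℤ) ^ k),
    ← geom_sum_mul_neg, mul_pow, mul_assoc, h1, mul_one]

theorem coeff_mul_invOneSubPow {m : ℕ} (hm : 1 ≤ m) (q i : ℕ) :
    PowerSeries.coeff i ((1 - PowerSeries.X ^ q) ^ m * (PowerSeries.invOneSubPow ℤ m).val) =
      ∑ j ∈ Finset.range (m + 1), (-1) ^ j * (m.choose j : ℤ) *
        intBinom ((i : ℤ) - (j : ℤ) * (q : ℤ) + (m : ℤ) - 1) ((i : ℤ) - (j : ℤ) * (q : ℤ)) := by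
  rw [sub_eq_neg_add, add_pow, Finset.sum_mul, map_sum]
  refine Finset.sum_congr rfl fun j _ => ?_
  have h : (-(PowerSeries.X : PowerSeries ℤ) ^ q) ^ j * 1 ^ (m - j) * (m.choose j : PowerSeries ℤ) *
      (PowerSeries.invOneSubPow ℤ m).val = PowerSeries.C ((-1) ^ j * (m.choose j : ℤ)) *
        (PowerSeries.X ^ (j * q) * (PowerSeries.invOneSubPow ℤ m).val) := by
    rw [neg_pow, ← pow_mul, mul_comm q j]
    simp only [map_mul, map_pow, map_neg, map_one, map_natCast, one_pow]
    ring
  rw [h, PowerSeries.coeff_C_mul, PowerSeries.coeff_X_pow_mul',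
    PowerSeries.invOneSubPow_val_eq_mk_sub_one_add_choose_of_pos ℤ m hm, PowerSeries.coeff_mk]
  congr 1
  unfold intBinom
  split_ifs with h1 h2 h2
  · have : ((j * q : ℕ) : ℤ) ≤ i := by exact_mod_cast h1
    push_cast at this
    omega
  -- The series has coefficient `C(m - 1 + d, m - 1)`, which is `C(d + m - 1, d)` by symmetry; here
  -- `1 ≤ m` makes the truncated `m - 1` harmless.
  · obtain ⟨d, rfl⟩ := Nat.exists_eq_add_of_le h1
    obtain ⟨k, rfl⟩ := Nat.exists_eq_add_of_le hm
    have e1 : ((j * q + d : ℕ) : ℤ) - j * q = (d : ℕ) := by push_cast; ring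
    have e2 : ((d : ℕ) : ℤ) + ((1 + k : ℕ) : ℤ) - 1 = ((d + k : ℕ) : ℤ) := by push_cast; ring
    rw [e1, e2, Int.toNat_natCast, Ring.choose_natCast, Nat.add_sub_cancel_left,
      Nat.add_sub_cancel_left, Nat.add_comm k d, Nat.choose_symm_add]
  · rfl
  · exfalso
    apply h1
    have : ((j * q : ℕ) : ℤ) ≤ i := by push_cast; omega
    exact_mod_cast this

theorem card_exponents_eq_grmRank {m : ℕ} (hm : 1 ≤ m) (q ν : ℕ) :
    (Fintype.card {e : Fin m → Fin q // ∑ j, (e j : ℕ) ≤ ν} : ℤ) = grmRank q ν m := by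
  have h : Fintype.card {e : Fin m → Fin q // ∑ j, (e j : ℕ) ≤ ν} =
      ∑ i ∈ Finset.range (ν + 1), Fintype.card {e : Fin m → Fin q // ∑ j, (e j : ℕ) = i} := by
    simp only [Fintype.card_subtype]
    rw [Finset.card_eq_sum_card_fiberwise (f := fun e => ∑ j, (e j : ℕ))
      (t := Finset.range (ν + 1))]
    · refine Finset.sum_congr rfl fun i hi => ?_
      rw [Finset.filter_filter]
      congr 1
      ext e
      simp only [Finset.mem_range] at hi
      simp only [Finset.mem_filter, Finset.mem_univ, true_and]
      omega
    · intro e he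
      simp only [Finset.coe_filter, Finset.mem_univ, true_and, Set.mem_ofPred_eq] at he
      simp only [Finset.coe_range, Set.mem_Iio]
      omega
  rw [h, grmRank]
  push_cast
  refine Finset.sum_congr rfl fun i _ => ?_
  rw [card_eq_coeff_geom_pow, geom_pow_eq_mul_invOneSubPow, coeff_mul_invOneSubPow hm]

/-! ### The residue field of a Galois ring. -/

theorem ker_castHom_zmod_pow (p : ℕ) {s : ℕ} (hs : 1 ≤ s) :
    RingHom.ker (ZMod.castHom (dvd_pow_self p (by omega : s ≠ 0)) (ZMod p)) =
      Ideal.span {(p : ZMod (p ^ s))} := by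
  ext x
  obtain ⟨n, rfl⟩ := ZMod.intCast_surjective x
  rw [RingHom.mem_ker, map_intCast, ZMod.intCast_zmod_eq_zero_iff_dvd, Ideal.mem_span_singleton]
  constructor
  · rintro ⟨k, rfl⟩
    exact ⟨k, by push_cast; rfl⟩
  · rintro ⟨y, hy⟩
    have h := congrArg (ZMod.castHom (dvd_pow_self p (by omega : s ≠ 0)) (ZMod p)) hy
    rw [map_mul, map_natCast, map_intCast, ZMod.natCast_self, zero_mul,
      ZMod.intCast_zmod_eq_zero_iff_dvd] at h
    exact h

/-- The residue ring of `ℤ/p^s` modulo `p` is `ℤ/p`. -/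
noncomputable def quotientZModPowEquiv (p : ℕ) {s : ℕ} (hs : 1 ≤ s) :
    ZMod (p ^ s) ⧸ Ideal.span {(p : ZMod (p ^ s))} ≃+* ZMod p :=
  (Ideal.quotEquivOfEq (ker_castHom_zmod_pow p hs).symm).trans
    (RingHom.quotientKerEquivOfSurjective (ZMod.castHom_surjective _))

/-- The residue ring of a Galois ring, as an adjunction to the residue ring of `ℤ/p^s`. -/
noncomputable def residueEquiv {L : Type*} [CommRing L] {p s : ℕ} {f : (ZMod (p ^ s))[X]}
    (φ : L ≃+* AdjoinRoot f) :
    L ⧸ Ideal.span {(p : L)} ≃+* AdjoinRoot (redMod p f) :=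
  (Ideal.quotientEquiv _ ((Ideal.span {(p : ZMod (p ^ s))}).map (AdjoinRoot.of f)) φ (by
    simp [Ideal.map_span])).trans
    (AdjoinRoot.quotAdjoinRootEquivQuotPolynomialQuot (Ideal.span {(p : ZMod (p ^ s))}) f)

theorem IsGaloisRing.isField_and_card {L : Type*} [CommRing L] {p s r : ℕ} (hp : p.Prime)
    (hs : 1 ≤ s) (hL : IsGaloisRing p s r L) :
    IsField (L ⧸ Ideal.span {(p : L)}) ∧ Nat.card (L ⧸ Ideal.span {(p : L)}) = p ^ r := by
  obtain ⟨f, hf, hr, hirr, ⟨φ⟩⟩ := hL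
  have : Fact p.Prime := ⟨hp⟩
  have hF : IsField (ZMod (p ^ s) ⧸ Ideal.span {(p : ZMod (p ^ s))}) :=
    (quotientZModPowEquiv p hs).toMulEquiv.isField (Field.toIsField (ZMod p))
  let := hF.toField
  have : Fact (Irreducible (redMod p f)) := ⟨hirr⟩
  have hmon : (redMod p f).Monic := hf.map _
  refine ⟨(residueEquiv φ).toMulEquiv.isField (Field.toIsField (AdjoinRoot (redMod p f))), ?_⟩
  have := hmon.finite_adjoinRoot
  rw [Nat.card_congr (residueEquiv φ).toEquiv, Module.natCard_eq_pow_finrank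
    (K := ZMod (p ^ s) ⧸ Ideal.span {(p : ZMod (p ^ s))}),
    Nat.card_congr (quotientZModPowEquiv p hs).toEquiv, Nat.card_zmod,
    (AdjoinRoot.powerBasis' hmon).finrank, AdjoinRoot.powerBasis'_dim, redMod,
    hf.natDegree_map, hr]

theorem IsGaloisRing.isNilpotent_span {L : Type*} [CommRing L] {p s r : ℕ}
    (hL : IsGaloisRing p s r L) : IsNilpotent (Ideal.span {(p : L)}) := by
  obtain ⟨f, -, -, -, ⟨φ⟩⟩ := hL
  refine ⟨s, ?_⟩
  rw [Ideal.span_singleton_pow, Ideal.zero_eq_bot, Ideal.span_singleton_eq_bot]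
  apply φ.injective
  have h : AdjoinRoot.of f ((p ^ s : ℕ) : ZMod (p ^ s)) = 0 := by rw [ZMod.natCast_self, map_zero]
  simpa only [map_natCast, map_pow, Nat.cast_pow, map_zero] using h

/-! ### The evaluation points modulo `p`, and the conclusion. -/

/-- The reduced coordinates of `ξ ^ i` determine `ζ ^ i`, where `ζ` is the reduction of `ξ`. Since
`ζ` has order `q ^ m - 1`, these powers are distinct and nonzero. -/
theorem residue_grmPoint_injective {L : Type*} [CommRing L] {p q m : ℕ} {h : L[X]}
    (hh : IsPrimitiveModulus p q m h) :
    Function.Injective fun (c : Option (Fin (q ^ m - 1))) (j : Fin m) =>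
      Ideal.Quotient.mk (Ideal.span {(p : L)}) (grmPoint hh c j) := by
  have : Nontrivial (AdjoinRoot (redMod p h)) :=
    Ideal.Quotient.nontrivial_iff.2 fun ht =>
      hh.basicPrimitive.2.1.not_isUnit (Ideal.span_singleton_eq_top.1 ht)
  set ζ := AdjoinRoot.root (redMod p h) with hζ
  have hord : orderOf ζ = q ^ m - 1 := hh.basicPrimitive.2.2
  have hζ0 : ∀ i : Fin (q ^ m - 1), ζ ^ (i : ℕ) ≠ 0 := by
    intro i h0
    have h1 := pow_orderOf_eq_one ζ
    rw [hord, ← Nat.add_sub_of_le i.2.le, pow_add, h0, zero_mul] at h1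
    exact zero_ne_one h1
  let red : AdjoinRoot h →+* AdjoinRoot (redMod p h) :=
    AdjoinRoot.map (Ideal.Quotient.mk (Ideal.span {(p : L)})) h (redMod p h) dvd_rfl
  have hroot : red (AdjoinRoot.root h) = ζ := AdjoinRoot.map_root _ _ _ _
  have hof : ∀ a, red (AdjoinRoot.of h a) = AdjoinRoot.of (redMod p h) (Ideal.Quotient.mk _ a) :=
    AdjoinRoot.map_of _ _ _ _
  have key : ∀ i : Fin (q ^ m - 1), ζ ^ (i : ℕ) = ∑ j : Fin m,
      AdjoinRoot.of (redMod p h) (Ideal.Quotient.mk _ (grmPoint hh (some i) j)) * ζ ^ (j : ℕ) := by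
    intro i
    have := congrArg red (root_pow_eq_sum_grmPoint hh i)
    simpa only [map_pow, map_sum, map_mul, hroot, hof, Algebra.smul_def,
      AdjoinRoot.algebraMap_eq] using this
  have hzero : ∀ i : Fin (q ^ m - 1), (fun j : Fin m =>
      Ideal.Quotient.mk (Ideal.span {(p : L)}) (grmPoint hh (some i) j)) ≠ fun j =>
      Ideal.Quotient.mk (Ideal.span {(p : L)}) (grmPoint hh none j) := by
    intro i hi
    refine hζ0 i ((key i).trans (Finset.sum_eq_zero fun j _ => ?_))
    rw [show Ideal.Quotient.mk (Ideal.span {(p : L)}) (grmPoint hh (some i) j) = 0 by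
      simpa [grmPoint] using congrFun hi j, map_zero, zero_mul]
  rintro (_ | i) (_ | i') heq
  · rfl
  · exact absurd heq.symm (hzero i')
  · exact absurd heq (hzero i)
  · have : ζ ^ (i : ℕ) = ζ ^ (i' : ℕ) := by
      rw [key i, key i']
      exact Finset.sum_congr rfl fun j _ => by rw [show Ideal.Quotient.mk (Ideal.span {(p : L)})
        (grmPoint hh (some i) j) = _ from congrFun heq j]
    congr 1
    exact Fin.ext (pow_injOn_Iio_orderOf (by simp [hord]) (by simp [hord]) this)

theorem linearIndependent_monomialWord_grmPoint {p s r m : ℕ} (hp : p.Prime) (hs : 1 ≤ s)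
    (hr : 1 ≤ r) (hm : 1 ≤ m) {L : Type*} [CommRing L] (hL : IsGaloisRing p s r L)
    {h : L[X]} (hh : IsPrimitiveModulus p (p ^ r) m h) :
    LinearIndependent L (monomialWord (grmPoint hh) : (Fin m → Fin (p ^ r)) → _ → L) := by
  obtain ⟨hF, hcard⟩ := hL.isField_and_card hp hs
  have hq : 2 ≤ p ^ r := hp.two_le.trans (Nat.le_self_pow (by omega) p)
  have hqm : 2 ≤ (p ^ r) ^ m := hq.trans (Nat.le_self_pow (by omega) _)
  have hinj := residue_grmPoint_injective hh
  let := hF.toField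
  have : Finite (L ⧸ Ideal.span {(p : L)}) := Nat.finite_of_card_ne_zero (by omega)
  have := Fintype.ofFinite (L ⧸ Ideal.span {(p : L)})
  have hbij := (Fintype.bijective_iff_injective_and_card _).2 ⟨hinj, by
    rw [Nat.card_eq_fintype_card] at hcard
    simp only [Fintype.card_option, Fintype.card_fin, Fintype.card_pi, Finset.prod_const,
      Finset.card_univ, hcard]
    omega⟩
  -- Any bijection serves: it only makes the matrix of words square.
  have ε : (Fin m → Fin (p ^ r)) ≃ Option (Fin ((p ^ r) ^ m - 1)) := Fintype.equivOfCardEq (by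
    simp only [Fintype.card_option, Fintype.card_fin, Fintype.card_pi, Finset.prod_const,
      Finset.card_univ]
    omega)
  refine linearIndependent_of_nilpotent_quotient hL.isNilpotent_span hF ε _ ?_
  have := linearIndependent_monomialWord_of_bijective (by omega) hcard hbij
  have hw : ∀ e : Fin m → Fin (p ^ r),
      (fun c => Ideal.Quotient.mk (Ideal.span {(p : L)}) (monomialWord (grmPoint hh) e c)) =
      monomialWord (fun c j => Ideal.Quotient.mk (Ideal.span {(p : L)}) (grmPoint hh c j)) e := by
    intro e
    ext c
    simp only [monomialWord, map_prod, map_pow]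
  rw [← funext hw] at this
  exact this

theorem mainTheorem1 {p s r m ν : ℕ} (hp : p.Prime) (hs : 1 ≤ s) (hr : 1 ≤ r) (hm : 1 ≤ m)
    (hrm : s ≤ r * m) (hν : ν ≤ m * (p ^ r - 1))
    {L : Type*} [CommRing L] (hL : IsGaloisRing p s r L)
    {h : Polynomial L} (hh : IsPrimitiveModulus p (p ^ r) m h) :
    Module.Free L (grmCode hh ν) ∧
      (Module.finrank L (grmCode hh ν) : ℤ) = grmRank (p ^ r) ν m ∧
      ∀ (K : Type*) [Field K], Nat.card K = p ^ r →
        Module.finrank K (fieldGRMCode K (p ^ r) ν m) = Module.finrank L (grmCode hh ν) := by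
  have hq : 0 < p ^ r := pow_pos hp.pos r
  have : Nontrivial (L ⧸ Ideal.span {(p : L)}) := (hL.isField_and_card hp hs).1.nontrivial
  have : Nontrivial L := (Ideal.Quotient.mk (Ideal.span {(p : L)})).domain_nontrivial
  have hli := linearIndependent_monomialWord_grmPoint hp hs hr hm hL hh
  refine ⟨free_evalCode hq hli ν, ?_, fun K _ hK => ?_⟩
  · rw [grmCode, finrank_evalCode hq hli, card_exponents_eq_grmRank hm]
  · rw [grmCode, finrank_evalCode hq hli, fieldGRMCode,
      finrank_evalCode hq (linearIndependent_monomialWord_id hq hK)]
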